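/- Let $(\mathcal A;\mathcal E)$ be a Frobenius category, i.e. an additive category with a Quillen exact structure that has enough projective and enough injective objects and whose projective and injective objects coincide. Let $\underline{\mathcal A}$ be its stable category ($\underline{\mathrm{Hom}}(A,B)$ is $\mathrm{Hom}(A,B)$ modulo the morphisms that factor through a projective object), $\pi\colon\mathcal A\to\underline{\mathcal A}$ the quotient functor, and for each object $A$ fix a conflation $A\to E_A\to\Sigma(A)$ with $E_A$ injective; $A\mapsto\pi(\Sigma(A))$ is the cosyzygy functor $\mathcal A\to\underline{\mathcal A}$. Both functors are additive, full and dense, and $\pi(\mathcal I)$, $\pi(\Sigma(\mathcal J))$ denote the ideals of $\underline{\mathcal A}$ that are the images (closed under isomorphism) of ideals $\mathcal I$, $\mathcal J$ of $\mathcal A$ under $\pi$ and under the cosyzygy functor, respectively. A pair $(\mathcal I,\mathcal J)$ of ideals of $\mathcal A$ is an ideal cotorsion pair if $\mathcal I=\{i \mid \mathrm{Ext}(i,j)=0\ \forall j\in\mathcal J\}$ and $\mathcal J=\{j\mid \mathrm{Ext}(i,j)=0\ \forall i\in\mathcal I\}$, where $\mathrm{Ext}(i,j)$ pulls a conflation back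 along $i$ and pushes it out along $j$. It is complete if every object $X$ has an $\mathrm{Ext}$-special $\mathcal I$-precover and an $\mathrm{Ext}$-special $\mathcal J$-preenvelope. Here an $\mathrm{Ext}$-special $\mathcal I$-precover of $X$ is a deflation $i\colon T\to X$ in $\mathcal I$ with a conflation $F\to T\xrightarrow{i}X$ that is the pushout of a conflation $K\to P\to X$, $P$ projective, along some $g\colon K\to F$ with $\mathrm{Ext}(i',g)=0$ for all $i'\in\mathcal I$; $\mathrm{Ext}$-special $\mathcal J$-preenvelopes are defined dually. A pair $(\mathcal U,\mathcal V)$ of ideals of $\underline{\mathcal A}$ is an ideal torsion pair if $\mathcal U=\{u\mid \mathrm{Hom}(u,v)=0\ \forall v\in\mathcal V\}$ and $\mathcal V=\{v\mid\mathrm{Hom}(u,v)=0\ \forall u\in\mathcal U\}$, where $\mathrm{Hom}(u,v)$ is the map $x\mapsto vxu$. It is complete if every object $X$ of $\underline{\mathcal A}$ has a $\mathcal U$-precover $T\to X$ (a morphism in $\mathcal U$ through which every morphism $T'\to X$ in $\mathcal U$ factors) that is the first morphism of some distinguished triangle $T\to X\to Z\to\Sigma(T)$, and, dually, a $\mathcal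 V$-preenvelope $X\to F$ that is the second morphism of some distinguished triangle $Z\to X\to F\to\Sigma(Z)$. The distinguished triangles are those isomorphic to some $\pi(A)\xrightarrow{\pi(f)}\pi(B)\to\pi(D)\to\pi(\Sigma(A))$, where $B\to D\to\Sigma(A)$ is the pushout of $A\to E_A\to\Sigma(A)$ along a morphism $f\colon A\to B$ of $\mathcal A$. Then $(\mathcal I,\mathcal J)\mapsto(\pi(\mathcal I),\pi(\Sigma(\mathcal J)))$ is a bijection from the ideal cotorsion pairs in $(\mathcal A;\mathcal E)$ onto the ideal torsion pairs in $\underline{\mathcal A}$, and an ideal cotorsion pair $(\mathcal I,\mathcal J)$ is complete if and only if the corresponding ideal torsion pair $(\pi(\mathcal I),\pi(\Sigma(\mathcal J)))$ is complete. -/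

import Mathlib

open CategoryTheory CategoryTheory.Limits

universe v u v' u'

/-! ### Ideals of preadditive categories -/

section Ideals

/-- An ideal of a preadditive category: an additive subbifunctor of `Hom`. -/
@[ext]
structure MorIdeal (C : Type u) [Category.{v} C] [Preadditive C] where
  hom : ∀ X Y : C, AddSubgroup (X ⟶ Y)
  comp_mem : ∀ {X A B Y : C} (f : X ⟶ A) {x : A ⟶ B} (g : B ⟶ Y),
    x ∈ hom A B → f ≫ x ≫ g ∈ hom X Y

namespace MorIdeal

variable {C : Type u} [Category.{v} C] [Preadditive C]
variable {D : Type u'} [Category.{v'} D] [Preadditive D]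

/-- The image of an ideal under an additive functor that is full and dense: the isomorphism
closure of the class of all `F(j)`, `j ∈ I`. It is an ideal of the target category. -/
def image (F : C ⥤ D) [F.Additive] [F.Full] [F.EssSurj] (I : MorIdeal C) : MorIdeal D where
  hom X Y :=
    { carrier := {h | ∃ (A B : C) (a : X ≅ F.obj A) (b : F.obj B ≅ Y) (j : A ⟶ B),
        j ∈ I.hom A B ∧ h = a.hom ≫ F.map j ≫ b.hom}
      zero_mem' := ⟨F.objPreimage X, F.objPreimage Y, (F.objObjPreimageIso X).symm,
        F.objObjPreimageIso Y, 0, (I.hom _ _).zero_mem, by simp⟩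
      add_mem' := by
        rintro _ _ ⟨A, B, a, b, j, hj, rfl⟩ ⟨A', B', a', b', j', hj', rfl⟩
        obtain ⟨s, hs⟩ := F.map_surjective (a.inv ≫ a'.hom)
        obtain ⟨t, ht⟩ := F.map_surjective (b'.hom ≫ b.inv)
        refine ⟨A, B, a, b, j + s ≫ j' ≫ t, (I.hom _ _).add_mem hj (I.comp_mem s t hj'), ?_⟩
        simp [Functor.map_add, hs, ht]
      neg_mem' := by
        rintro _ ⟨A, B, a, b, j, hj, rfl⟩
        exact ⟨A, B, a, b, -j, (I.hom _ _).neg_mem hj, by simp [Functor.map_neg]⟩ }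
  comp_mem := by
    rintro X X' Y' Y f _ g ⟨A, B, a, b, j, hj, rfl⟩
    obtain ⟨s, hs⟩ := F.map_surjective ((F.objObjPreimageIso X).hom ≫ f ≫ a.hom)
    obtain ⟨t, ht⟩ := F.map_surjective (b.hom ≫ g ≫ (F.objObjPreimageIso Y).inv)
    refine ⟨F.objPreimage X, F.objPreimage Y, (F.objObjPreimageIso X).symm,
      F.objObjPreimageIso Y, s ≫ j ≫ t, I.comp_mem s t hj, ?_⟩
    simp [hs, ht]

/-- `Hom(f, g) = 0`. -/
def HomOrthogonal {X A B Y : C} (f : X ⟶ A) (g : B ⟶ Y) : Prop :=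
  ∀ x : A ⟶ B, f ≫ x ≫ g = 0

/-- `(I, J)` is an ideal torsion pair: `I = ⊥J` and `J = I⊥` with respect to `Hom`. -/
def IsTorsionPair (I J : MorIdeal C) : Prop :=
  (∀ ⦃X A : C⦄ (i : X ⟶ A), i ∈ I.hom X A ↔
    ∀ ⦃B Y : C⦄ (j : B ⟶ Y), j ∈ J.hom B Y → HomOrthogonal i j) ∧
  (∀ ⦃B Y : C⦄ (j : B ⟶ Y), j ∈ J.hom B Y ↔
    ∀ ⦃X A : C⦄ (i : X ⟶ A), i ∈ I.hom X A → HomOrthogonal i j)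

/-- `i : T ⟶ X` is an `I`-precover of `X`. -/
def IsPrecover (I : MorIdeal C) {T X : C} (i : T ⟶ X) : Prop :=
  i ∈ I.hom T X ∧ ∀ ⦃T' : C⦄ (i' : T' ⟶ X), i' ∈ I.hom T' X → ∃ t : T' ⟶ T, t ≫ i = i'

/-- `j : X ⟶ F` is a `J`-preenvelope of `X`. -/
def IsPreenvelope (J : MorIdeal C) {X F : C} (j : X ⟶ F) : Prop :=
  j ∈ J.hom X F ∧ ∀ ⦃F' : C⦄ (j' : X ⟶ F'), j' ∈ J.hom X F' → ∃ t : F ⟶ F', j ≫ t = j'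

/-- Every object has an `I`-precover that is a weak inflation, where `W` is the collection of
weak conflations. -/
def HomSpecialPrecovering (W : ∀ ⦃X Y Z : C⦄, (X ⟶ Y) → (Y ⟶ Z) → Prop) (I : MorIdeal C) : Prop :=
  ∀ X : C, ∃ (T : C) (i : T ⟶ X), I.IsPrecover i ∧ ∃ (Z : C) (c : X ⟶ Z), W i c

/-- Every object has a `J`-preenvelope that is a weak deflation, where `W` is the collection of
weak conflations. -/
def HomSpecialPreenveloping (W : ∀ ⦃X Y Z : C⦄, (X ⟶ Y) → (Y ⟶ Z) → Prop) (J : MorIdeal C) :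
    Prop :=
  ∀ X : C, ∃ (F : C) (j : X ⟶ F), J.IsPreenvelope j ∧ ∃ (Z : C) (k : Z ⟶ X), W k j

/-- `(I, J)` is a complete ideal torsion pair with respect to the weak conflations `W`. -/
structure IsCompleteTorsionPair (W : ∀ ⦃X Y Z : C⦄, (X ⟶ Y) → (Y ⟶ Z) → Prop)
    (I J : MorIdeal C) : Prop where
  torsionPair : IsTorsionPair I J
  precovering : HomSpecialPrecovering W I
  preenveloping : HomSpecialPreenveloping W J

end MorIdeal

end Ideals

/-! ### Exact categories -/

section Exact

/-- A (Quillen) exact structure on an additive category: a class of kernel-cokernel pairs, closed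
under isomorphism, such that identities are inflations and deflations, inflations (deflations) are
closed under composition, and pushouts of inflations (pullbacks of deflations) along arbitrary
morphisms exist and are inflations (deflations). -/
structure ExactStructure (C : Type u) [Category.{v} C] [Preadditive C]
    [HasFiniteBiproducts C] where
  conflation : ShortComplex C → Prop
  of_iso : ∀ {S S' : ShortComplex C}, (S ≅ S') → conflation S → conflation S'
  kernel : ∀ {S : ShortComplex C}, conflation S → Nonempty (IsLimit (KernelFork.ofι S.f S.zero))
  cokernel : ∀ {S : ShortComplex C}, conflation S →
    Nonempty (IsColimit (CokernelCofork.ofπ S.g S.zero))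
  id_inflation : ∀ A : C,
    ∃ (Z : C) (c : A ⟶ Z) (w : 𝟙 A ≫ c = 0), conflation (.mk (𝟙 A) c w)
  id_deflation : ∀ A : C,
    ∃ (Z : C) (k : Z ⟶ A) (w : k ≫ 𝟙 A = 0), conflation (.mk k (𝟙 A) w)
  comp_inflation : ∀ {A B D : C} (f : A ⟶ B) (g : B ⟶ D),
    (∃ (Z : C) (c : B ⟶ Z) (w : f ≫ c = 0), conflation (.mk f c w)) →
    (∃ (Z : C) (c : D ⟶ Z) (w : g ≫ c = 0), conflation (.mk g c w)) →
    ∃ (Z : C) (c : D ⟶ Z) (w : (f ≫ g) ≫ c = 0), conflation (.mk (f ≫ g) c w)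
  comp_deflation : ∀ {A B D : C} (f : A ⟶ B) (g : B ⟶ D),
    (∃ (Z : C) (k : Z ⟶ A) (w : k ≫ f = 0), conflation (.mk k f w)) →
    (∃ (Z : C) (k : Z ⟶ B) (w : k ≫ g = 0), conflation (.mk k g w)) →
    ∃ (Z : C) (k : Z ⟶ A) (w : k ≫ f ≫ g = 0), conflation (.mk k (f ≫ g) w)
  pushout_inflation : ∀ {A B A' : C} (i : A ⟶ B) (f : A ⟶ A'),
    (∃ (Z : C) (c : B ⟶ Z) (w : i ≫ c = 0), conflation (.mk i c w)) →
    ∃ (B' : C) (f' : B ⟶ B') (i' : A' ⟶ B'), IsPushout i f f' i' ∧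
      ∃ (Z : C) (c : B' ⟶ Z) (w : i' ≫ c = 0), conflation (.mk i' c w)
  pullback_deflation : ∀ {B D D' : C} (p : B ⟶ D) (f : D' ⟶ D),
    (∃ (Z : C) (k : Z ⟶ B) (w : k ≫ p = 0), conflation (.mk k p w)) →
    ∃ (B' : C) (f' : B' ⟶ B) (p' : B' ⟶ D'), IsPullback f' p' p f ∧
      ∃ (Z : C) (k : Z ⟶ B') (w : k ≫ p' = 0), conflation (.mk k p' w)

namespace ExactStructure

variable {C : Type u} [Category.{v} C] [Preadditive C] [HasFiniteBiproducts C]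
variable (E : ExactStructure C)

/-- `(k, c)` is a conflation. -/
def Conf {A B D : C} (k : A ⟶ B) (c : B ⟶ D) : Prop :=
  ∃ w : k ≫ c = 0, E.conflation (.mk k c w)

/-- `k` is an inflation. -/
def Inflation {A B : C} (k : A ⟶ B) : Prop := ∃ (D : C) (c : B ⟶ D), E.Conf k c

/-- `c` is a deflation. -/
def Deflation {B D : C} (c : B ⟶ D) : Prop := ∃ (A : C) (k : A ⟶ B), E.Conf k c

/-- `P` is a projective object of the exact category. -/
def Proj (P : C) : Prop :=
  ∀ ⦃B D : C⦄ (c : B ⟶ D), E.Deflation c → ∀ f : P ⟶ D, ∃ g : P ⟶ B, g ≫ c = f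

/-- `Q` is an injective object of the exact category. -/
def Inj (Q : C) : Prop :=
  ∀ ⦃A B : C⦄ (k : A ⟶ B), E.Inflation k → ∀ f : A ⟶ Q, ∃ g : B ⟶ Q, k ≫ g = f

/-- The exact category is Frobenius. -/
class IsFrobenius : Prop where
  enough_proj : ∀ A : C, ∃ (P : C) (p : P ⟶ A), E.Proj P ∧ E.Deflation p
  enough_inj : ∀ A : C, ∃ (Q : C) (q : A ⟶ Q), E.Inj Q ∧ E.Inflation q
  proj_iff_inj : ∀ P : C, E.Proj P ↔ E.Inj P

/-- `Ext(f, g) = 0`: for every conflation `B ⟶ M ⟶ A`, its pullback `B ⟶ M' ⟶ X` along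
`f : X ⟶ A`, followed by the pushout `Y ⟶ M'' ⟶ X` along `g : B ⟶ Y`, is a split conflation. -/
def ExtOrthogonal {X A B Y : C} (f : X ⟶ A) (g : B ⟶ Y) : Prop :=
  ∀ ⦃M M' M'' : C⦄ (k : B ⟶ M) (c : M ⟶ A) (k' : B ⟶ M') (c' : M' ⟶ X)
    (k'' : Y ⟶ M'') (c'' : M'' ⟶ X) (m : M' ⟶ M) (n : M' ⟶ M''),
    E.Conf k c → E.Conf k' c' → E.Conf k'' c'' →
    IsPullback m c' c f → k' ≫ m = k →
    IsPushout k' g n k'' → n ≫ c'' = c' →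
    ∃ s : X ⟶ M'', s ≫ c'' = 𝟙 X

/-- `(I, J)` is an ideal cotorsion pair: `I = ⊥J` and `J = I⊥` with respect to `Ext`. -/
def IsCotorsionPair (I J : MorIdeal C) : Prop :=
  (∀ ⦃X A : C⦄ (i : X ⟶ A), i ∈ I.hom X A ↔
    ∀ ⦃B Y : C⦄ (j : B ⟶ Y), j ∈ J.hom B Y → E.ExtOrthogonal i j) ∧
  (∀ ⦃B Y : C⦄ (j : B ⟶ Y), j ∈ J.hom B Y ↔
    ∀ ⦃X A : C⦄ (i : X ⟶ A), i ∈ I.hom X A → E.ExtOrthogonal i j)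

/-- `i : T ⟶ X` is an `Ext`-special `I`-precover: it lies in `I` and there is a commutative
diagram of conflations from `K ⟶ P ⟶ X` (`P` projective) to `F ⟶ T ⟶ X`, the identity on `X`
and on kernels a morphism `g : K ⟶ F` with `Ext(I, g) = 0`. -/
def IsExtSpecialPrecover (I : MorIdeal C) {T X : C} (i : T ⟶ X) : Prop :=
  i ∈ I.hom T X ∧ ∃ (K P F : C) (k : K ⟶ P) (p : P ⟶ X) (l : F ⟶ T) (g : K ⟶ F) (h : P ⟶ T),
    E.Proj P ∧ E.Conf k p ∧ E.Conf l i ∧ g ≫ l = k ≫ h ∧ h ≫ i = p ∧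
    ∀ ⦃X' A' : C⦄ (i' : X' ⟶ A'), i' ∈ I.hom X' A' → E.ExtOrthogonal i' g

/-- `j : X ⟶ F` is an `Ext`-special `J`-preenvelope: it lies in `J` and there is a commutative
diagram of conflations from `X ⟶ F ⟶ T` to `X ⟶ Q ⟶ K` (`Q` injective), the identity on `X`
and on cokernels a morphism `g : T ⟶ K` with `Ext(g, J) = 0`. -/
def IsExtSpecialPreenvelope (J : MorIdeal C) {X F : C} (j : X ⟶ F) : Prop :=
  j ∈ J.hom X F ∧ ∃ (T Q K : C) (q : X ⟶ Q) (c : Q ⟶ K) (d : F ⟶ T) (g : T ⟶ K) (h : F ⟶ Q),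
    E.Inj Q ∧ E.Conf q c ∧ E.Conf j d ∧ d ≫ g = h ≫ c ∧ j ≫ h = q ∧
    ∀ ⦃B' Y' : C⦄ (j' : B' ⟶ Y'), j' ∈ J.hom B' Y' → E.ExtOrthogonal g j'

/-- `(I, J)` is a complete ideal cotorsion pair. -/
structure IsCompleteCotorsionPair (I J : MorIdeal C) : Prop where
  cotorsionPair : E.IsCotorsionPair I J
  precovering : ∀ X : C, ∃ (T : C) (i : T ⟶ X), E.IsExtSpecialPrecover I i
  preenveloping : ∀ X : C, ∃ (F : C) (j : X ⟶ F), E.IsExtSpecialPreenvelope J j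

/-! ### The stable category -/

/-- `f` factors through a projective object. -/
def FactorsProj {A B : C} (f : A ⟶ B) : Prop :=
  ∃ (P : C) (a : A ⟶ P) (b : P ⟶ B), E.Proj P ∧ a ≫ b = f

/-- The relation whose quotient is the stable category. -/
def stableRel : HomRel C := fun _ _ f g => E.FactorsProj (f - g)

variable {E}

theorem Proj.biprod {P Q : C} [HasBinaryBiproduct P Q] (hP : E.Proj P) (hQ : E.Proj Q) :
    E.Proj (P ⊞ Q) := by
  intro B D c hc f
  obtain ⟨g, hg⟩ := hP c hc (biprod.inl ≫ f)
  obtain ⟨h, hh⟩ := hQ c hc (biprod.inr ≫ f)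
  exact ⟨biprod.desc g h, by ext <;> simp [hg, hh]⟩

theorem FactorsProj.add {A B : C} {f g : A ⟶ B} (hf : E.FactorsProj f) (hg : E.FactorsProj g) :
    E.FactorsProj (f + g) := by
  obtain ⟨P, a, b, hP, rfl⟩ := hf
  obtain ⟨Q, a', b', hQ, rfl⟩ := hg
  have : HasBinaryBiproducts C := hasBinaryBiproducts_of_finite_biproducts C
  exact ⟨P ⊞ Q, biprod.lift a a', biprod.desc b b', hP.biprod hQ, by simp⟩

theorem FactorsProj.neg {A B : C} {f : A ⟶ B} (hf : E.FactorsProj f) : E.FactorsProj (-f) := by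
  obtain ⟨P, a, b, hP, rfl⟩ := hf
  exact ⟨P, -a, b, hP, by simp⟩

theorem FactorsProj.comp {X A B Y : C} (s : X ⟶ A) {f : A ⟶ B} (hf : E.FactorsProj f)
    (t : B ⟶ Y) : E.FactorsProj (s ≫ f ≫ t) := by
  obtain ⟨P, a, b, hP, rfl⟩ := hf
  exact ⟨P, s ≫ a, b ≫ t, hP, by simp⟩

theorem proj_zero_factors {A B : C} : E.FactorsProj (0 : A ⟶ B) := by
  have : HasZeroObject C := hasZeroObject_of_hasFiniteBiproducts C
  obtain ⟨Z, hZ⟩ := HasZeroObject.zero (C := C)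
  exact ⟨Z, 0, 0, fun _ _ _ _ f => ⟨0, hZ.eq_of_src _ _⟩, by simp⟩

variable (E)

instance : Congruence E.stableRel where
  equivalence :=
    { refl := fun f => by simpa [stableRel] using proj_zero_factors
      symm := fun h => by simpa [stableRel] using FactorsProj.neg h
      trans := fun h h' => by simpa [stableRel] using FactorsProj.add h h' }
  comp_left f g g' h := by
    simpa [stableRel, Preadditive.comp_sub] using FactorsProj.comp f h (𝟙 _)
  comp_right g h := by
    simpa [stableRel, Preadditive.sub_comp] using FactorsProj.comp (𝟙 _) h g

/-- The stable category: the quotient of `C` by the morphisms that factor through a projective. -/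
abbrev Stable := CategoryTheory.Quotient E.stableRel

theorem stableRel_add ⦃X Y : C⦄ (f₁ f₂ g₁ g₂ : X ⟶ Y) (hf : E.stableRel f₁ f₂)
    (hg : E.stableRel g₁ g₂) : E.stableRel (f₁ + g₁) (f₂ + g₂) := by
  have h := FactorsProj.add hf hg
  rwa [show f₁ - f₂ + (g₁ - g₂) = f₁ + g₁ - (f₂ + g₂) by abel] at h

instance : Preadditive E.Stable := Quotient.preadditive _ E.stableRel_add

/-- The stable quotient functor. -/
abbrev stab : C ⥤ E.Stable := Quotient.functor E.stableRel

instance : E.stab.Additive := Quotient.functor_additive _ E.stableRel_add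

theorem stab_map_eq_iff {A B : C} (f g : A ⟶ B) :
    E.stab.map f = E.stab.map g ↔ E.FactorsProj (f - g) :=
  Quotient.functor_map_eq_iff E.stableRel f g

/-! ### The cosyzygy functor -/

variable {E}

theorem Conf.lift {A B D : C} {k : A ⟶ B} {c : B ⟶ D} (h : E.Conf k c) {X : C} (x : X ⟶ B)
    (hx : x ≫ c = 0) : ∃ y : X ⟶ A, y ≫ k = x := by
  obtain ⟨w, hw⟩ := h
  obtain ⟨hl⟩ := E.kernel hw
  exact ⟨(KernelFork.IsLimit.lift' hl x hx).1, (KernelFork.IsLimit.lift' hl x hx).2⟩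

theorem Conf.desc {A B D : C} {k : A ⟶ B} {c : B ⟶ D} (h : E.Conf k c) {X : C} (x : B ⟶ X)
    (hx : k ≫ x = 0) : ∃ y : D ⟶ X, c ≫ y = x := by
  obtain ⟨w, hw⟩ := h
  obtain ⟨hl⟩ := E.cokernel hw
  exact ⟨(CokernelCofork.IsColimit.desc' hl x hx).1, (CokernelCofork.IsColimit.desc' hl x hx).2⟩

theorem Conf.epi {A B D : C} {k : A ⟶ B} {c : B ⟶ D} (h : E.Conf k c) : Epi c := by
  obtain ⟨w, hw⟩ := h
  obtain ⟨hl⟩ := E.cokernel hw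
  exact ⟨fun x y hxy => Cofork.IsColimit.hom_ext hl hxy⟩

/-- `(f, e, s)` is a morphism from `A ⟶ Q ⟶ S` to `A' ⟶ Q' ⟶ S'` for some `e`. -/
def IsCosyzygyMap {A Q S A' Q' S' : C} (k : A ⟶ Q) (c : Q ⟶ S) (k' : A' ⟶ Q') (c' : Q' ⟶ S')
    (f : A ⟶ A') (s : S ⟶ S') : Prop :=
  ∃ e : Q ⟶ Q', k ≫ e = f ≫ k' ∧ c ≫ s = e ≫ c'

theorem IsCosyzygyMap.comp {A Q S A' Q' S' A'' Q'' S'' : C} {k : A ⟶ Q} {c : Q ⟶ S}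
    {k' : A' ⟶ Q'} {c' : Q' ⟶ S'} {k'' : A'' ⟶ Q''} {c'' : Q'' ⟶ S''} {f : A ⟶ A'} {s : S ⟶ S'}
    {f' : A' ⟶ A''} {s' : S' ⟶ S''} (h : IsCosyzygyMap k c k' c' f s)
    (h' : IsCosyzygyMap k' c' k'' c'' f' s') :
    IsCosyzygyMap k c k'' c'' (f ≫ f') (s ≫ s') := by
  obtain ⟨e, he, hs⟩ := h
  obtain ⟨e', he', hs'⟩ := h'
  refine ⟨e ≫ e', ?_, ?_⟩
  · rw [← Category.assoc, he, Category.assoc, he', Category.assoc]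
  · rw [← Category.assoc, hs, Category.assoc, hs', Category.assoc]

theorem exists_cosyzygyMap {A Q S A' Q' S' : C} {k : A ⟶ Q} {c : Q ⟶ S} {k' : A' ⟶ Q'}
    {c' : Q' ⟶ S'} (h : E.Conf k c) (h' : E.Conf k' c') (hQ' : E.Inj Q') (f : A ⟶ A') :
    ∃ s : S ⟶ S', IsCosyzygyMap k c k' c' f s := by
  obtain ⟨e, he⟩ := hQ' k ⟨_, _, h⟩ (f ≫ k')
  have w' := h'.1
  obtain ⟨s, hs⟩ := h.desc (e ≫ c') (by rw [← Category.assoc, he, Category.assoc, w', comp_zero])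
  exact ⟨s, e, he, hs⟩

variable [E.IsFrobenius]

theorem exists_of_cosyzygy {A Q S A' Q' S' : C} {k : A ⟶ Q} {c : Q ⟶ S} {k' : A' ⟶ Q'}
    {c' : Q' ⟶ S'} (h : E.Conf k c) (h' : E.Conf k' c') (hQ : E.Inj Q) (s : S ⟶ S') :
    ∃ f : A ⟶ A', IsCosyzygyMap k c k' c' f s := by
  obtain ⟨e, he⟩ := (IsFrobenius.proj_iff_inj Q).2 hQ c' ⟨_, _, h'⟩ (c ≫ s)
  have w := h.1
  obtain ⟨f, hf⟩ := h'.lift (k ≫ e) (by rw [Category.assoc, he, ← Category.assoc, w, zero_comp])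
  exact ⟨f, e, hf.symm, he.symm⟩

theorem cosyzygyMap_unique {A Q S A' Q' S' : C} {k : A ⟶ Q} {c : Q ⟶ S} {k' : A' ⟶ Q'}
    {c' : Q' ⟶ S'} (h : E.Conf k c) (h' : E.Conf k' c') (hQ' : E.Inj Q') {f f' : A ⟶ A'}
    {s s' : S ⟶ S'} (hs : IsCosyzygyMap k c k' c' f s) (hs' : IsCosyzygyMap k c k' c' f' s')
    (hf : E.stab.map f = E.stab.map f') : E.stab.map s = E.stab.map s' := by
  rw [stab_map_eq_iff] at hf ⊢
  obtain ⟨P, a, b, hP, hab⟩ := hf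
  obtain ⟨e, he, hes⟩ := hs
  obtain ⟨e', he', hes'⟩ := hs'
  obtain ⟨a', ha'⟩ := (IsFrobenius.proj_iff_inj P).1 hP k ⟨_, _, h⟩ a
  obtain ⟨t, ht⟩ := h.desc (e - e' - a' ≫ b ≫ k') (by
    rw [Preadditive.comp_sub, Preadditive.comp_sub, he, he', ← Category.assoc k a', ha',
      ← Category.assoc a b, hab, Preadditive.sub_comp, sub_self])
  refine ⟨Q', t, c', (IsFrobenius.proj_iff_inj Q').2 hQ', ?_⟩
  have := h.epi
  have w' := h'.1
  rw [← cancel_epi c, ← Category.assoc, ht, Preadditive.comp_sub, hes, hes']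
  simp [Preadditive.sub_comp, w']

variable (E)

theorem exists_cosyzygy (A : C) :
    ∃ (Q S : C) (k : A ⟶ Q) (c : Q ⟶ S), E.Inj Q ∧ E.Conf k c := by
  obtain ⟨Q, q, hQ, S, c, h⟩ := IsFrobenius.enough_inj (E := E) A
  exact ⟨Q, S, q, c, hQ, h⟩

/-- The injective object in a fixed conflation `A ⟶ Q ⟶ Σ(A)`. -/
noncomputable def injHull (A : C) : C := (E.exists_cosyzygy A).choose

/-- The cosyzygy object `Σ(A)`. -/
noncomputable def cosyz (A : C) : C := (E.exists_cosyzygy A).choose_spec.choose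

/-- The inflation of the fixed conflation `A ⟶ Q ⟶ Σ(A)`. -/
noncomputable def cosyzι (A : C) : A ⟶ E.injHull A :=
  (E.exists_cosyzygy A).choose_spec.choose_spec.choose

/-- The deflation of the fixed conflation `A ⟶ Q ⟶ Σ(A)`. -/
noncomputable def cosyzπ (A : C) : E.injHull A ⟶ E.cosyz A :=
  (E.exists_cosyzygy A).choose_spec.choose_spec.choose_spec.choose

theorem injHull_inj (A : C) : E.Inj (E.injHull A) :=
  (E.exists_cosyzygy A).choose_spec.choose_spec.choose_spec.choose_spec.1

theorem cosyz_conf (A : C) : E.Conf (E.cosyzι A) (E.cosyzπ A) :=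
  (E.exists_cosyzygy A).choose_spec.choose_spec.choose_spec.choose_spec.2

/-- `s` is a cosyzygy morphism `Σ(f)` of `f`. -/
def IsSigma {A B : C} (f : A ⟶ B) (s : E.cosyz A ⟶ E.cosyz B) : Prop :=
  IsCosyzygyMap (E.cosyzι A) (E.cosyzπ A) (E.cosyzι B) (E.cosyzπ B) f s

theorem exists_isSigma {A B : C} (f : A ⟶ B) : ∃ s, E.IsSigma f s :=
  exists_cosyzygyMap (E.cosyz_conf A) (E.cosyz_conf B) (E.injHull_inj B) f

variable {E}

theorem IsSigma.unique {A B : C} {f f' : A ⟶ B} {s s' : E.cosyz A ⟶ E.cosyz B}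
    (hs : E.IsSigma f s) (hs' : E.IsSigma f' s') (hf : E.stab.map f = E.stab.map f') :
    E.stab.map s = E.stab.map s' :=
  cosyzygyMap_unique (E.cosyz_conf A) (E.cosyz_conf B) (E.injHull_inj B) hs hs' hf

variable (E)

/-- The functor `Σ` from `C` to the stable category, `A ↦ π(Σ(A))`, `f ↦ π(Σ(f))`. -/
noncomputable def sigma : C ⥤ E.Stable where
  obj A := E.stab.obj (E.cosyz A)
  map f := E.stab.map (E.exists_isSigma f).choose
  map_id A := by
    rw [← E.stab.map_id]
    exact (E.exists_isSigma (𝟙 A)).choose_spec.unique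
      (show E.IsSigma (𝟙 A) (𝟙 _) from ⟨𝟙 _, by simp, by simp⟩) rfl
  map_comp f g := by
    rw [← E.stab.map_comp]
    exact (E.exists_isSigma (f ≫ g)).choose_spec.unique
      ((E.exists_isSigma f).choose_spec.comp (E.exists_isSigma g).choose_spec) rfl

theorem sigma_map {A B : C} {f : A ⟶ B} {s : E.cosyz A ⟶ E.cosyz B} (h : E.IsSigma f s) :
    E.sigma.map f = E.stab.map s :=
  (E.exists_isSigma f).choose_spec.unique h rfl

instance : E.sigma.Additive where
  map_add {A B f g} := by
    obtain ⟨s, hs⟩ := E.exists_isSigma f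
    obtain ⟨t, ht⟩ := E.exists_isSigma g
    rw [E.sigma_map hs, E.sigma_map ht]
    obtain ⟨e, he, hes⟩ := hs
    obtain ⟨e', he', het⟩ := ht
    exact (E.sigma_map (s := s + t) ⟨e + e', by simp [he, he'], by simp [hes, het]⟩).trans
      E.stab.map_add

instance : E.sigma.Full where
  map_surjective {A B} g := by
    obtain ⟨s, rfl⟩ := E.stab.map_surjective g
    obtain ⟨f, hf⟩ := exists_of_cosyzygy (E.cosyz_conf A) (E.cosyz_conf B) (E.injHull_inj A) s
    exact ⟨f, E.sigma_map hf⟩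

instance : E.sigma.EssSurj where
  mem_essImage X := by
    obtain ⟨P, p, hP, K, k, h⟩ := IsFrobenius.enough_proj (E := E) X.as
    have hP' := (IsFrobenius.proj_iff_inj (E := E) P).1 hP
    obtain ⟨s, hs⟩ := exists_cosyzygyMap (E.cosyz_conf K) h hP' (𝟙 K)
    obtain ⟨t, ht⟩ := exists_cosyzygyMap h (E.cosyz_conf K) (E.injHull_inj K) (𝟙 K)
    refine ⟨K, ⟨⟨E.stab.map s, E.stab.map t, ?_, ?_⟩⟩⟩
    · refine (E.stab.map_comp s t).symm.trans (Eq.trans ?_ (E.stab.map_id _))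
      exact cosyzygyMap_unique (E.cosyz_conf K) (E.cosyz_conf K) (E.injHull_inj K)
        (hs.comp ht) (f' := 𝟙 K) ⟨𝟙 _, by simp, by simp⟩ (by simp)
    · refine (E.stab.map_comp t s).symm.trans (Eq.trans ?_ (E.stab.map_id _))
      exact cosyzygyMap_unique h h hP' (ht.comp hs) (f' := 𝟙 K) ⟨𝟙 _, by simp, by simp⟩ (by simp)

/-- The shift endofunctor of the stable category induced by `Σ`. -/
noncomputable def stableShift : E.Stable ⥤ E.Stable :=
  CategoryTheory.Quotient.lift E.stableRel E.sigma (fun _ _ f g h => by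
    obtain ⟨s, hs⟩ := E.exists_isSigma f
    obtain ⟨t, ht⟩ := E.exists_isSigma g
    rw [E.sigma_map hs, E.sigma_map ht]
    exact hs.unique ht ((E.stab_map_eq_iff f g).2 h))

/-- A distinguished triangle `X ⟶ Y ⟶ Z ⟶ Σ(X)` of the stable category: one that is isomorphic to
a standard triangle `π(A) ⟶ π(B) ⟶ π(D) ⟶ π(Σ(A))`, where `A ⟶ B` is a morphism `f` of `C` and
`B ⟶ D ⟶ Σ(A)` is the pushout along `f` of the fixed conflation `A ⟶ Q ⟶ Σ(A)`. -/
def IsTriangle {X Y Z : E.Stable} (x : X ⟶ Y) (y : Y ⟶ Z) (z : Z ⟶ E.stableShift.obj X) : Prop :=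
  ∃ (A B D : C) (f : A ⟶ B) (g : B ⟶ D) (q : E.injHull A ⟶ D) (w : D ⟶ E.cosyz A)
    (a : X ≅ E.stab.obj A) (b : Y ≅ E.stab.obj B) (d : Z ≅ E.stab.obj D),
    IsPushout (E.cosyzι A) f q g ∧ q ≫ w = E.cosyzπ A ∧ g ≫ w = 0 ∧
    x ≫ b.hom = a.hom ≫ E.stab.map f ∧ y ≫ d.hom = b.hom ≫ E.stab.map g ∧
    z ≫ E.stableShift.map a.hom = d.hom ≫ E.stab.map w

/-- The weak conflations of the stable category: the pairs of consecutive morphisms that start a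
distinguished triangle. -/
def StableWeakConf ⦃X Y Z : E.Stable⦄ (x : X ⟶ Y) (y : Y ⟶ Z) : Prop :=
  ∃ z : Z ⟶ E.stableShift.obj X, E.IsTriangle x y z

end ExactStructure

end Exact

/-!
A conflation `Y ⟶ M ⟶ X` has a connecting morphism `δ : π(X) ⟶ π(Σ(Y))` in the stable category.
It is natural in both ends, it vanishes exactly when the conflation splits, and every morphism
`π(X) ⟶ π(Σ(Y))` arises in this way. Hence `Ext(f, g) = 0` if and only if `Hom(π(f), π(Σ(g))) = 0`,
so `(I, J)` is an ideal cotorsion pair exactly when `I` is the inverse image under `π` of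
`⊥π(Σ(J))` and `J` is the inverse image under `Σ` of `π(I)⊥`. Since `π` and `Σ` are full and dense,
every ideal is the image of its inverse image, and the bijection follows formally.

Pulling back and pushing out conflations, the morphisms that lift along a deflation are those killed
by `δ` on the right, and dually for extensions along an inflation. It follows that an `Ext`-special
`I`-precover is the same thing as an `I`-precover that is a deflation. A precover `π(i)` in the
stable category is made into a deflation by adding to `i` a deflation from a projective object,
which does not change it stably; on the other side every stable morphism can be completed to a
distinguished triangle in either direction, so completeness on both sides is the mere existence
of precovers and preenvelopes.
-/

/-! ### Orthogonals, images and inverse images of ideals -/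

namespace MorIdeal

variable {C : Type u} [Category.{v} C] [Preadditive C]
variable {D : Type u'} [Category.{v'} D] [Preadditive D]

theorem comp_left_mem (I : MorIdeal C) {X A B : C} (f : X ⟶ A) {x : A ⟶ B}
    (hx : x ∈ I.hom A B) : f ≫ x ∈ I.hom X B := by
  simpa using I.comp_mem f (𝟙 _) hx

theorem comp_right_mem (I : MorIdeal C) {A B Y : C} {x : A ⟶ B} (g : B ⟶ Y)
    (hx : x ∈ I.hom A B) : x ≫ g ∈ I.hom A Y := by
  simpa using I.comp_mem (𝟙 _) g hx

/-- The inverse image of an ideal under an additive functor. -/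
def comap (F : C ⥤ D) [F.Additive] (U : MorIdeal D) : MorIdeal C where
  hom X Y := (U.hom (F.obj X) (F.obj Y)).comap F.mapAddHom
  comp_mem f _ g hx := by simpa using U.comp_mem (F.map f) (F.map g) hx

theorem mem_comap {F : C ⥤ D} [F.Additive] {U : MorIdeal D} {X Y : C} {f : X ⟶ Y} :
    f ∈ (U.comap F).hom X Y ↔ F.map f ∈ U.hom _ _ := Iff.rfl

/-- The left orthogonal `⊥V` of an ideal `V` with respect to `Hom`. -/
def leftPerp (V : MorIdeal C) : MorIdeal C where
  hom X A :=
    { carrier := {u | ∀ ⦃B Y : C⦄ (v : B ⟶ Y), v ∈ V.hom B Y → HomOrthogonal u v}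
      zero_mem' := fun _ _ _ _ x => by simp
      add_mem' := fun hu hu' B Y v hv x => by simp [hu v hv x, hu' v hv x]
      neg_mem' := fun hu B Y v hv x => by simp [hu v hv x] }
  comp_mem f _ g hu B Y v hv x := by
    simpa using f ≫= hu v hv (g ≫ x)

/-- The right orthogonal `U⊥` of an ideal `U` with respect to `Hom`. -/
def rightPerp (U : MorIdeal C) : MorIdeal C where
  hom B Y :=
    { carrier := {v | ∀ ⦃X A : C⦄ (u : X ⟶ A), u ∈ U.hom X A → HomOrthogonal u v}
      zero_mem' := fun _ _ _ _ x => by simp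
      add_mem' := fun hv hv' X A u hu x => by simp [hv u hu x, hv' u hu x]
      neg_mem' := fun hv X A u hu x => by simp [hv u hu x] }
  comp_mem f _ g hv X A u hu x := by
    simpa using hv u hu (x ≫ f) =≫ g

theorem eq_iff {I J : MorIdeal C} :
    I = J ↔ ∀ ⦃X Y : C⦄ (f : X ⟶ Y), f ∈ I.hom X Y ↔ f ∈ J.hom X Y :=
  ⟨by rintro rfl; simp, fun h => by ext X Y f; exact h f⟩

theorem isTorsionPair_iff {U V : MorIdeal C} :
    IsTorsionPair U V ↔ U = V.leftPerp ∧ V = U.rightPerp := by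
  rw [eq_iff, eq_iff]
  rfl

section Image

variable {F : C ⥤ D} [F.Additive] [F.Full] [F.EssSurj] {I : MorIdeal C}

theorem map_mem_image {A B : C} {f : A ⟶ B} (hf : f ∈ I.hom A B) :
    F.map f ∈ (I.image F).hom _ _ :=
  ⟨A, B, Iso.refl _, Iso.refl _, f, hf, by simp⟩

theorem exists_of_map_mem_image {A B : C} {f : A ⟶ B} (hf : F.map f ∈ (I.image F).hom _ _) :
    ∃ g ∈ I.hom A B, F.map g = F.map f := by
  obtain ⟨A', B', a, b, j, hj, h⟩ := hf
  obtain ⟨s, hs⟩ := F.map_surjective a.hom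
  obtain ⟨t, ht⟩ := F.map_surjective b.hom
  exact ⟨s ≫ j ≫ t, I.comp_mem s t hj, by simp [h, hs, ht]⟩

theorem image_comap (U : MorIdeal D) : (U.comap F).image F = U := by
  rw [eq_iff]
  refine fun X Y f => ⟨?_, fun hf => ?_⟩
  · rintro ⟨A, B, a, b, j, hj, rfl⟩
    exact U.comp_mem _ _ hj
  · obtain ⟨s, hs⟩ := F.map_surjective
      ((F.objObjPreimageIso X).hom ≫ f ≫ (F.objObjPreimageIso Y).inv)
    refine ⟨_, _, (F.objObjPreimageIso X).symm, F.objObjPreimageIso Y, s, ?_, by simp [hs]⟩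
    rw [mem_comap, hs]
    exact U.comp_mem _ _ hf

theorem image_eq_of_eq_comap {U : MorIdeal D} (h : I = U.comap F) : I.image F = U := by
  rw [h, image_comap]

theorem comap_image_of_eq_comap {U : MorIdeal D} (h : I = U.comap F) :
    (I.image F).comap F = I := by
  rw [image_eq_of_eq_comap h, ← h]

theorem mem_leftPerp_image {X A : D} {u : X ⟶ A} :
    u ∈ (I.image F).leftPerp.hom X A ↔
      ∀ ⦃B Y : C⦄ (j : B ⟶ Y), j ∈ I.hom B Y → HomOrthogonal u (F.map j) := by
  refine ⟨fun h B Y j hj => h _ (map_mem_image hj), ?_⟩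
  rintro h B Y _ ⟨B', Y', a, b, j, hj, rfl⟩ x
  simpa using h j hj (x ≫ a.hom) =≫ b.hom

theorem mem_rightPerp_image {B Y : D} {v : B ⟶ Y} :
    v ∈ (I.image F).rightPerp.hom B Y ↔
      ∀ ⦃X A : C⦄ (i : X ⟶ A), i ∈ I.hom X A → HomOrthogonal (F.map i) v := by
  refine ⟨fun h X A i hi => h _ (map_mem_image hi), ?_⟩
  rintro h X A _ ⟨X', A', a, b, i, hi, rfl⟩ x
  simpa using a.hom ≫= h i hi (b.hom ≫ x)

theorem bijOn_image_isTorsionPair (F G : C ⥤ D) [F.Additive] [F.Full] [F.EssSurj]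
    [G.Additive] [G.Full] [G.EssSurj] :
    Set.BijOn (fun p : MorIdeal C × MorIdeal C => (p.1.image F, p.2.image G))
      {p | p.1 = (p.2.image G).leftPerp.comap F ∧ p.2 = (p.1.image F).rightPerp.comap G}
      {q | IsTorsionPair q.1 q.2} := by
  refine Set.InvOn.bijOn (f' := fun q => (q.1.comap F, q.2.comap G)) ⟨?_, ?_⟩ ?_ ?_
  · rintro ⟨I, J⟩ ⟨hI, hJ⟩
    exact Prod.ext (comap_image_of_eq_comap hI) (comap_image_of_eq_comap hJ)
  · rintro ⟨U, V⟩ -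
    exact Prod.ext (image_comap U) (image_comap V)
  · rintro ⟨I, J⟩ ⟨hI, hJ⟩
    exact isTorsionPair_iff.2 ⟨image_eq_of_eq_comap hI, image_eq_of_eq_comap hJ⟩
  · rintro ⟨U, V⟩ h
    obtain ⟨hU, hV⟩ := isTorsionPair_iff.1 h
    exact ⟨by simp only [image_comap, ← hU], by simp only [image_comap, ← hV]⟩

end Image

section Approximations

variable {I : MorIdeal C}

theorem IsPrecover.iso_comp_iso {T T' X X' : C} {i : T ⟶ X} (hi : I.IsPrecover i) (a : T' ≅ T)
    (b : X ≅ X') : I.IsPrecover (a.hom ≫ i ≫ b.hom) := by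
  refine ⟨I.comp_mem _ _ hi.1, fun S f hf => ?_⟩
  obtain ⟨t, ht⟩ := hi.2 (f ≫ b.inv) (I.comp_right_mem _ hf)
  exact ⟨t ≫ a.inv, by simp [reassoc_of% ht]⟩

theorem IsPreenvelope.iso_comp_iso {X X' T T' : C} {j : X ⟶ T} (hj : I.IsPreenvelope j)
    (a : X' ≅ X) (b : T ≅ T') : I.IsPreenvelope (a.hom ≫ j ≫ b.hom) := by
  refine ⟨I.comp_mem _ _ hj.1, fun S f hf => ?_⟩
  obtain ⟨t, ht⟩ := hj.2 (a.inv ≫ f) (I.comp_left_mem _ hf)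
  exact ⟨b.inv ≫ t, by simp [ht]⟩

variable {F : C ⥤ D} [F.Additive] [F.Full] [F.EssSurj]

theorem IsPrecover.map {T X : C} {i : T ⟶ X} (hi : I.IsPrecover i) :
    (I.image F).IsPrecover (F.map i) := by
  refine ⟨map_mem_image hi.1, fun S f hf => ?_⟩
  let e := F.objObjPreimageIso S
  obtain ⟨f', hf'⟩ := F.map_surjective (e.hom ≫ f)
  obtain ⟨g, hg, hgf⟩ := exists_of_map_mem_image (hf' ▸ comp_left_mem _ e.hom hf)
  obtain ⟨t, rfl⟩ := hi.2 g hg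
  exact ⟨e.inv ≫ F.map t, by rw [Category.assoc, ← F.map_comp, hgf, hf', e.inv_hom_id_assoc]⟩

theorem IsPreenvelope.map {X T : C} {j : X ⟶ T} (hj : I.IsPreenvelope j) :
    (I.image F).IsPreenvelope (F.map j) := by
  refine ⟨map_mem_image hj.1, fun S f hf => ?_⟩
  let e := F.objObjPreimageIso S
  obtain ⟨f', hf'⟩ := F.map_surjective (f ≫ e.inv)
  obtain ⟨g, hg, hgf⟩ := exists_of_map_mem_image (hf' ▸ comp_right_mem _ e.inv hf)
  obtain ⟨t, rfl⟩ := hj.2 g hg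
  exact ⟨F.map t ≫ e.hom, by
    rw [← Category.assoc, ← F.map_comp, hgf, hf', Category.assoc, e.inv_hom_id, Category.comp_id]⟩

end Approximations

section DenseFunctor

variable {B : Type u} [Category.{v} B] (F : B ⥤ D) [F.Full] [F.EssSurj]

theorem forall_exists_isPrecover_iff_map (U : MorIdeal D) :
    (∀ X : D, ∃ (T : D) (u : T ⟶ X), U.IsPrecover u) ↔
      ∀ X : B, ∃ (T : B) (i : T ⟶ X), U.IsPrecover (F.map i) := by
  refine ⟨fun h X => ?_, fun h X => ?_⟩
  · obtain ⟨T, u, hu⟩ := h (F.obj X)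
    obtain ⟨i, hi⟩ := F.map_surjective ((F.objObjPreimageIso T).hom ≫ u)
    exact ⟨_, i, by simpa [hi] using hu.iso_comp_iso (F.objObjPreimageIso T) (Iso.refl _)⟩
  · obtain ⟨T, i, hi⟩ := h (F.objPreimage X)
    exact ⟨_, _, hi.iso_comp_iso (Iso.refl _) (F.objObjPreimageIso X)⟩

theorem forall_exists_isPreenvelope_iff_map (V : MorIdeal D) :
    (∀ X : D, ∃ (T : D) (v : X ⟶ T), V.IsPreenvelope v) ↔
      ∀ X : B, ∃ (T : B) (j : X ⟶ T), V.IsPreenvelope (F.map j) := by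
  refine ⟨fun h X => ?_, fun h X => ?_⟩
  · obtain ⟨T, v, hv⟩ := h (F.obj X)
    obtain ⟨j, hj⟩ := F.map_surjective (v ≫ (F.objObjPreimageIso T).inv)
    exact ⟨_, j, by simpa [hj] using hv.iso_comp_iso (Iso.refl _) (F.objObjPreimageIso T).symm⟩
  · obtain ⟨T, j, hj⟩ := h (F.objPreimage X)
    exact ⟨_, _, hj.iso_comp_iso (F.objObjPreimageIso X).symm (Iso.refl _)⟩

end DenseFunctor

end MorIdeal

section BiprodSquares

variable {C : Type u} [Category.{v} C] [Preadditive C]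

theorem isPullback_biprod_fst_snd_zero {T X Z : C} [HasBinaryBiproduct T X] :
    IsPullback (biprod.fst : T ⊞ X ⟶ T) biprod.snd (0 : T ⟶ Z) 0 :=
  ⟨⟨by simp⟩, ⟨PullbackCone.IsLimit.mk _ (fun s => biprod.lift s.fst s.snd) (by simp) (by simp)
    fun s m h₁ h₂ => by ext <;> simp [h₁, h₂]⟩⟩

theorem isPushout_zero_biprod_inl_inr {T X Z : C} [HasBinaryBiproduct T X] :
    IsPushout (0 : Z ⟶ T) 0 (biprod.inl : T ⟶ T ⊞ X) biprod.inr :=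
  ⟨⟨by simp⟩, ⟨PushoutCocone.IsColimit.mk _ (fun s => biprod.desc s.inl s.inr) (by simp) (by simp)
    fun s m h₁ h₂ => by ext <;> simp [h₁, h₂]⟩⟩

theorem isPullback_biprod_snd_shear {T P X : C} [HasBinaryBiproduct T P] [HasBinaryBiproduct T X]
    (f : T ⟶ X) (p : P ⟶ X) :
    IsPullback biprod.snd (biprod.lift biprod.fst (biprod.desc f p)) p
      (biprod.desc (-f) (𝟙 X)) := by
  refine ⟨⟨by ext <;> simp⟩, ⟨PullbackCone.IsLimit.mk _
    (fun s => biprod.lift (s.snd ≫ biprod.fst) s.fst) (by simp) (fun s => ?_)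
    fun s m h₁ h₂ => by ext <;> simp [← h₁, ← h₂]⟩⟩
  ext
  · simp
  · simp [s.condition, biprod.desc_eq]

theorem isPushout_biprod_inr_shear {X F Q : C} [HasBinaryBiproduct F X] [HasBinaryBiproduct F Q]
    (f : X ⟶ F) (q : X ⟶ Q) :
    IsPushout q (biprod.lift (-f) (𝟙 X)) biprod.inr
      (biprod.desc biprod.inl (biprod.lift f q)) := by
  refine ⟨⟨by ext <;> simp⟩, ⟨PushoutCocone.IsColimit.mk _
    (fun s => biprod.desc (biprod.inl ≫ s.inr) s.inl) (by simp) (fun s => ?_)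
    fun s m h₁ h₂ => by ext <;> simp [← h₁, ← h₂]⟩⟩
  ext
  · simp
  · simp [s.condition, biprod.lift_eq]

end BiprodSquares

namespace ExactStructure

variable {C : Type u} [Category.{v} C] [Preadditive C] [HasFiniteBiproducts C]
variable {E : ExactStructure C}

/-! ### Conflations -/

section Conflations

variable {A B D : C} {k : A ⟶ B} {c : B ⟶ D}

theorem Conf.mono (h : E.Conf k c) : Mono k := by
  obtain ⟨w, hw⟩ := h
  obtain ⟨hl⟩ := E.kernel hw
  exact ⟨fun x y hxy => Fork.IsLimit.hom_ext hl hxy⟩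

theorem Conf.of_iso {A' B' D' : C} {k' : A' ⟶ B'} {c' : B' ⟶ D'} (h : E.Conf k c)
    (a : A ≅ A') (b : B ≅ B') (d : D ≅ D') (hk : a.hom ≫ k' = k ≫ b.hom)
    (hc : b.hom ≫ c' = c ≫ d.hom) : E.Conf k' c' := by
  have w' : k' ≫ c' = 0 := by
    rw [← cancel_epi a.hom, reassoc_of% hk, hc, reassoc_of% h.1, zero_comp, comp_zero]
  exact ⟨w', E.of_iso (ShortComplex.isoMk a b d hk hc) h.2⟩

theorem Deflation.conf_of_isLimit (hc : E.Deflation c) {w : k ≫ c = 0}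
    (hk : IsLimit (KernelFork.ofι k w)) : E.Conf k c := by
  obtain ⟨A₀, k₀, h₀⟩ := hc
  obtain ⟨hk₀⟩ := E.kernel h₀.2
  exact h₀.of_iso (hk₀.conePointUniqueUpToIso hk) (Iso.refl _) (Iso.refl _)
    (by simpa using hk₀.conePointUniqueUpToIso_hom_comp hk WalkingParallelPair.zero) (by simp)

theorem Inflation.conf_of_isColimit (hk : E.Inflation k) {w : k ≫ c = 0}
    (hc : IsColimit (CokernelCofork.ofπ c w)) : E.Conf k c := by
  obtain ⟨D₀, c₀, h₀⟩ := hk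
  obtain ⟨hc₀⟩ := E.cokernel h₀.2
  exact h₀.of_iso (Iso.refl _) (Iso.refl _) (hc₀.coconePointUniqueUpToIso hc) (by simp)
    (by simpa using (hc₀.comp_coconePointUniqueUpToIso_hom hc WalkingParallelPair.one).symm)

theorem Deflation.of_isPullback (hc : E.Deflation c) {B' D' : C} {m : B' ⟶ B} {c' : B' ⟶ D'}
    {f : D' ⟶ D} (pb : IsPullback m c' c f) : E.Deflation c' := by
  obtain ⟨B₁, m₁, c₁, pb₁, Z, k₁, h₁⟩ := E.pullback_deflation c f hc
  let e := pb₁.isoIsPullback _ _ pb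
  exact ⟨Z, k₁ ≫ e.hom, Conf.of_iso h₁ (Iso.refl _) e (Iso.refl _) (by simp) (by simp [e])⟩

theorem Inflation.of_isPushout (hk : E.Inflation k) {A' B' : C} {n : B ⟶ B'} {k' : A' ⟶ B'}
    {f : A ⟶ A'} (po : IsPushout k f n k') : E.Inflation k' := by
  obtain ⟨B₁, n₁, k₁, po₁, Z, c₁, h₁⟩ := E.pushout_inflation k f hk
  let e := po₁.isoIsPushout _ _ po
  exact ⟨Z, e.inv ≫ c₁, Conf.of_iso h₁ (Iso.refl _) e (Iso.refl _) (by simp [e]) (by simp)⟩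

theorem Conf.pullback (h : E.Conf k c) {B' D' : C} {m : B' ⟶ B} {c' : B' ⟶ D'} {f : D' ⟶ D}
    (pb : IsPullback m c' c f) : ∃ k' : A ⟶ B', E.Conf k' c' ∧ k' ≫ m = k := by
  have hkm : pb.lift k 0 (by simp [h.1]) ≫ m = k := pb.lift_fst _ _ _
  have := h.mono
  have := mono_of_mono_fac hkm
  refine ⟨_, Deflation.conf_of_isLimit (Deflation.of_isPullback ⟨A, k, h⟩ pb)
    (KernelFork.IsLimit.ofι' _ (pb.lift_snd _ _ _) fun x hx => ?_), hkm⟩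
  have hxk := h.lift (x ≫ m) (by rw [Category.assoc, pb.w, reassoc_of% hx, zero_comp])
  exact ⟨hxk.choose, pb.hom_ext (by simpa using hxk.choose_spec) (by simp [hx])⟩

theorem Conf.pushout (h : E.Conf k c) {A' B' : C} {n : B ⟶ B'} {k' : A' ⟶ B'} {f : A ⟶ A'}
    (po : IsPushout k f n k') : ∃ c' : B' ⟶ D, E.Conf k' c' ∧ n ≫ c' = c := by
  have hnc : n ≫ po.desc c 0 (by simp [h.1]) = c := po.inl_desc _ _ _
  have := h.epi
  have := epi_of_epi_fac hnc
  refine ⟨_, Inflation.conf_of_isColimit (Inflation.of_isPushout ⟨D, c, h⟩ po)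
    (CokernelCofork.IsColimit.ofπ' _ (po.inr_desc _ _ _) fun x hx => ?_), hnc⟩
  have hcx := h.desc (n ≫ x) (by rw [← Category.assoc, po.w, Category.assoc, hx, comp_zero])
  exact ⟨hcx.choose, po.hom_ext (by simpa using hcx.choose_spec) (by simp [hx])⟩

theorem Conf.exists_pullback (h : E.Conf k c) {D' : C} (f : D' ⟶ D) :
    ∃ (B' : C) (k' : A ⟶ B') (c' : B' ⟶ D') (m : B' ⟶ B),
      IsPullback m c' c f ∧ E.Conf k' c' ∧ k' ≫ m = k := by
  obtain ⟨B', m, c', pb, -⟩ := E.pullback_deflation c f ⟨_, _, h⟩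
  obtain ⟨k', h', hk⟩ := h.pullback pb
  exact ⟨B', k', c', m, pb, h', hk⟩

theorem Conf.exists_pushout (h : E.Conf k c) {A' : C} (f : A ⟶ A') :
    ∃ (B' : C) (k' : A' ⟶ B') (c' : B' ⟶ D) (n : B ⟶ B'),
      IsPushout k f n k' ∧ E.Conf k' c' ∧ n ≫ c' = c := by
  obtain ⟨B', n, k', po, -⟩ := E.pushout_inflation k f ⟨_, _, h⟩
  obtain ⟨c', h', hc⟩ := h.pushout po
  exact ⟨B', k', c', n, po, h', hc⟩

theorem Conf.exists_section_of_retraction (h : E.Conf k c) {r : B ⟶ A} (hr : k ≫ r = 𝟙 A) :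
    ∃ s : D ⟶ B, s ≫ c = 𝟙 D ∧ c ≫ s = 𝟙 B - r ≫ k := by
  obtain ⟨s, hs⟩ := h.desc (𝟙 B - r ≫ k) (by simp [reassoc_of% hr])
  have := h.epi
  exact ⟨s, by rw [← cancel_epi c, reassoc_of% hs]; simp [h.1], hs⟩

theorem Conf.exists_retraction_of_section (h : E.Conf k c) {s : D ⟶ B} (hs : s ≫ c = 𝟙 D) :
    ∃ r : B ⟶ A, k ≫ r = 𝟙 A := by
  obtain ⟨r, hr⟩ := h.lift (𝟙 B - c ≫ s) (by simp [hs])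
  have := h.mono
  exact ⟨r, by rw [← cancel_mono k, Category.assoc, hr]; simp [reassoc_of% h.1]⟩

end Conflations

attribute [local instance] hasBinaryBiproducts_of_finite_biproducts

section Biproducts

theorem deflation_biprod_snd (T X : C) : E.Deflation (biprod.snd : T ⊞ X ⟶ X) := by
  obtain ⟨Z, c, h⟩ := E.id_inflation T
  obtain rfl : c = 0 := by simpa using h.1
  exact Deflation.of_isPullback ⟨T, 𝟙 T, h⟩ isPullback_biprod_fst_snd_zero

theorem inflation_biprod_inr (T X : C) : E.Inflation (biprod.inr : X ⟶ T ⊞ X) := by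
  obtain ⟨Z, k, h⟩ := E.id_deflation T
  obtain rfl : k = 0 := by simpa using h.1
  exact Inflation.of_isPushout ⟨T, 𝟙 T, h⟩ isPushout_zero_biprod_inl_inr

theorem Deflation.biprod_desc {T P X : C} {p : P ⟶ X} (hp : E.Deflation p) (f : T ⟶ X) :
    E.Deflation (biprod.desc f p) := by
  rw [← biprod.lift_snd (biprod.fst : T ⊞ P ⟶ T) (biprod.desc f p)]
  exact E.comp_deflation _ _ (hp.of_isPullback (isPullback_biprod_snd_shear f p))
    (deflation_biprod_snd T X)

theorem Inflation.biprod_lift {X F Q : C} {q : X ⟶ Q} (hq : E.Inflation q) (f : X ⟶ F) :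
    E.Inflation (biprod.lift f q) := by
  rw [← biprod.inr_desc (biprod.inl : F ⟶ F ⊞ Q) (biprod.lift f q)]
  exact E.comp_inflation _ _ (inflation_biprod_inr F X)
    (hq.of_isPushout (isPushout_biprod_inr_shear f q))

end Biproducts

/-! ### Morphisms of the stable category -/

theorem stab_map_eq_zero_iff {A B : C} {f : A ⟶ B} : E.stab.map f = 0 ↔ E.FactorsProj f := by
  rw [← E.stab.map_zero, stab_map_eq_iff, sub_zero]

theorem stab_map_comp_eq_zero {A P B : C} (hP : E.Proj P) (f : A ⟶ P) (g : P ⟶ B) :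
    E.stab.map (f ≫ g) = 0 :=
  stab_map_eq_zero_iff.2 ⟨P, f, g, hP, rfl⟩

theorem Deflation.exists_comp_eq_of_stab_map_eq_zero {A P B : C} {p : P ⟶ B} (hp : E.Deflation p)
    {f : A ⟶ B} (hf : E.stab.map f = 0) : ∃ u : A ⟶ P, u ≫ p = f := by
  obtain ⟨R, a, b, hR, rfl⟩ := stab_map_eq_zero_iff.1 hf
  obtain ⟨b', rfl⟩ := hR p hp b
  exact ⟨a ≫ b', Category.assoc _ _ _⟩

theorem isIso_stab_map_biprod_inl (A : C) {P : C} (hP : E.Proj P) :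
    IsIso (E.stab.map (biprod.inl : A ⟶ A ⊞ P)) := by
  refine ⟨E.stab.map biprod.fst, by simp [← E.stab.map_comp], ?_⟩
  rw [← E.stab.map_comp, ← E.stab.map_id, ← biprod.total, E.stab.map_add,
    stab_map_comp_eq_zero hP, add_zero]

theorem Conf.isIso_stab_map_of_inj [E.IsFrobenius] {Q B D : C} {k : Q ⟶ B} {c : B ⟶ D}
    (h : E.Conf k c) (hQ : E.Inj Q) : IsIso (E.stab.map c) := by
  obtain ⟨r, hr⟩ := hQ k ⟨_, _, h⟩ (𝟙 Q)
  obtain ⟨s, hsc, hcs⟩ := h.exists_section_of_retraction hr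
  refine ⟨E.stab.map s, ?_, by rw [← E.stab.map_comp, hsc, E.stab.map_id]⟩
  rw [← E.stab.map_comp, hcs, E.stab.map_sub,
    stab_map_comp_eq_zero ((IsFrobenius.proj_iff_inj Q).2 hQ), sub_zero, E.stab.map_id]

/-! ### The connecting morphism of a conflation -/

section Connecting

variable [E.IsFrobenius]

/-- The connecting morphism `π(X) ⟶ π(Σ(Y))` of a conflation `Y ⟶ M ⟶ X`: the stable class of any
morphism `X ⟶ Σ(Y)` that fits into a morphism of conflations from `Y ⟶ M ⟶ X` to the fixed
conflation `Y ⟶ Q ⟶ Σ(Y)` which is the identity on `Y`. It plays the role of the class of the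
conflation in `Ext(X, Y)`. -/
noncomputable def Conf.δ {Y M X : C} {k : Y ⟶ M} {c : M ⟶ X} (h : E.Conf k c) :
    E.stab.obj X ⟶ E.sigma.obj Y :=
  E.stab.map (exists_cosyzygyMap h (E.cosyz_conf Y) (E.injHull_inj Y) (𝟙 Y)).choose

variable {Y M X : C} {k : Y ⟶ M} {c : M ⟶ X}

theorem IsCosyzygyMap.δ_eq {s : X ⟶ E.cosyz Y}
    (hs : IsCosyzygyMap k c (E.cosyzι Y) (E.cosyzπ Y) (𝟙 Y) s) (h : E.Conf k c) :
    h.δ = E.stab.map s :=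
  cosyzygyMap_unique h (E.cosyz_conf Y) (E.injHull_inj Y)
    (exists_cosyzygyMap h (E.cosyz_conf Y) (E.injHull_inj Y) (𝟙 Y)).choose_spec hs rfl

theorem IsCosyzygyMap.δ_comp_sigma_map {Y' M' X' : C} {k' : Y' ⟶ M'} {c' : M' ⟶ X'} {f : Y ⟶ Y'}
    {s : X ⟶ X'} (hs : IsCosyzygyMap k c k' c' f s) (h : E.Conf k c) (h' : E.Conf k' c') :
    h.δ ≫ E.sigma.map f = E.stab.map s ≫ h'.δ := by
  obtain ⟨d, hd⟩ := exists_cosyzygyMap h (E.cosyz_conf Y) (E.injHull_inj Y) (𝟙 Y)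
  obtain ⟨d', hd'⟩ := exists_cosyzygyMap h' (E.cosyz_conf Y') (E.injHull_inj Y') (𝟙 Y')
  obtain ⟨t, ht⟩ := E.exists_isSigma f
  rw [hd.δ_eq h, hd'.δ_eq h', E.sigma_map ht]
  exact (E.stab.map_comp d t).symm.trans <| (cosyzygyMap_unique h (E.cosyz_conf Y')
    (E.injHull_inj Y') (hd.comp ht) (hs.comp hd') (by simp)).trans (E.stab.map_comp s d')

theorem Conf.δ_pullback {M' X' : C} {k' : Y ⟶ M'} {c' : M' ⟶ X'} {m : M' ⟶ M} {f : X' ⟶ X}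
    (h : E.Conf k c) (h' : E.Conf k' c') (hk : k' ≫ m = k) (hc : m ≫ c = c' ≫ f) :
    h'.δ = E.stab.map f ≫ h.δ := by
  have hf : IsCosyzygyMap k' c' k c (𝟙 Y) f := ⟨m, by simp [hk], hc.symm⟩
  simpa using hf.δ_comp_sigma_map h' h

theorem Conf.δ_pushout {Y' M' : C} {k' : Y' ⟶ M'} {c' : M' ⟶ X} {n : M ⟶ M'} {g : Y ⟶ Y'}
    (h : E.Conf k c) (h' : E.Conf k' c') (hk : k ≫ n = g ≫ k') (hc : n ≫ c' = c) :
    h'.δ = h.δ ≫ E.sigma.map g := by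
  have hg : IsCosyzygyMap k c k' c' g (𝟙 X) := ⟨n, hk, by simp [hc]⟩
  simpa using (hg.δ_comp_sigma_map h h').symm

theorem Conf.isIso_δ (h : E.Conf k c) (hM : E.Inj M) : IsIso h.δ := by
  obtain ⟨s, hs⟩ := exists_cosyzygyMap h (E.cosyz_conf Y) (E.injHull_inj Y) (𝟙 Y)
  obtain ⟨t, ht⟩ := exists_cosyzygyMap (E.cosyz_conf Y) h hM (𝟙 Y)
  rw [hs.δ_eq h]
  refine ⟨E.stab.map t, ?_, ?_⟩
  · refine (E.stab.map_comp s t).symm.trans (Eq.trans ?_ (E.stab.map_id _))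
    exact cosyzygyMap_unique h h hM (hs.comp ht) (f' := 𝟙 Y) ⟨𝟙 _, by simp, by simp⟩ (by simp)
  · refine (E.stab.map_comp t s).symm.trans (Eq.trans ?_ (E.stab.map_id _))
    exact cosyzygyMap_unique (E.cosyz_conf Y) (E.cosyz_conf Y) (E.injHull_inj Y)
      (ht.comp hs) (f' := 𝟙 Y) ⟨𝟙 _, by simp, by simp⟩ (by simp)

theorem Conf.exists_retraction_iff (h : E.Conf k c) : (∃ r : M ⟶ Y, k ≫ r = 𝟙 Y) ↔ h.δ = 0 := by
  obtain ⟨s, hs⟩ := exists_cosyzygyMap h (E.cosyz_conf Y) (E.injHull_inj Y) (𝟙 Y)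
  have ⟨e, he, hes⟩ := hs
  rw [Category.id_comp] at he
  rw [hs.δ_eq h]
  constructor
  · rintro ⟨r, hr⟩
    have h0 : IsCosyzygyMap k c (E.cosyzι Y) (E.cosyzπ Y) (𝟙 Y) 0 :=
      ⟨r ≫ E.cosyzι Y, by rw [reassoc_of% hr, Category.id_comp], by simp [(E.cosyz_conf Y).1]⟩
    exact (hs.δ_eq h).symm.trans ((h0.δ_eq h).trans (E.stab.map_zero _ _))
  · intro h0
    obtain ⟨P, a, b, hP, rfl⟩ := stab_map_eq_zero_iff.1 h0
    obtain ⟨t, ht⟩ := hP (E.cosyzπ Y) ⟨_, _, E.cosyz_conf Y⟩ b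
    obtain ⟨r, hr⟩ := (E.cosyz_conf Y).lift (e - c ≫ a ≫ t) (by simp [ht, hes])
    have := (E.cosyz_conf Y).mono
    exact ⟨r, by rw [← cancel_mono (E.cosyzι Y), Category.assoc, hr]; simp [he, reassoc_of% h.1]⟩

theorem Conf.exists_section_iff (h : E.Conf k c) : (∃ s : X ⟶ M, s ≫ c = 𝟙 X) ↔ h.δ = 0 := by
  rw [← h.exists_retraction_iff]
  refine ⟨fun ⟨s, hs⟩ => h.exists_retraction_of_section hs, fun ⟨r, hr⟩ => ?_⟩
  obtain ⟨s, hs, -⟩ := h.exists_section_of_retraction hr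
  exact ⟨s, hs⟩

theorem Conf.exists_lift_iff (h : E.Conf k c) {X' : C} (x : X' ⟶ X) :
    (∃ t : X' ⟶ M, t ≫ c = x) ↔ E.stab.map x ≫ h.δ = 0 := by
  obtain ⟨M', k', c', m, pb, h', hk⟩ := h.exists_pullback x
  rw [← h.δ_pullback h' hk pb.w, ← h'.exists_section_iff]
  constructor
  · rintro ⟨t, ht⟩
    exact ⟨pb.lift t (𝟙 _) (by simp [ht]), pb.lift_snd _ _ _⟩
  · rintro ⟨s, hs⟩
    exact ⟨s ≫ m, by rw [Category.assoc, pb.w, reassoc_of% hs]⟩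

theorem Conf.exists_extension_iff (h : E.Conf k c) {Y' : C} (y : Y ⟶ Y') :
    (∃ t : M ⟶ Y', k ≫ t = y) ↔ h.δ ≫ E.sigma.map y = 0 := by
  obtain ⟨M', k', c', n, po, h', hc⟩ := h.exists_pushout y
  rw [← h.δ_pushout h' po.w hc, ← h'.exists_retraction_iff]
  constructor
  · rintro ⟨t, ht⟩
    exact ⟨po.desc t (𝟙 _) (by simp [ht]), po.inr_desc _ _ _⟩
  · rintro ⟨r, hr⟩
    exact ⟨n ≫ r, by rw [← Category.assoc, po.w, Category.assoc, hr, Category.comp_id]⟩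

theorem sigma_map_eq_zero_iff {A B : C} {f : A ⟶ B} :
    E.sigma.map f = 0 ↔ ∃ t : E.injHull A ⟶ B, E.cosyzι A ≫ t = f := by
  have := (E.cosyz_conf A).isIso_δ (E.injHull_inj A)
  rw [(E.cosyz_conf A).exists_extension_iff, Preadditive.IsIso.comp_left_eq_zero]

theorem sigma_map_comp_eq_zero {A Q B : C} (hQ : E.Inj Q) (f : A ⟶ Q) (g : Q ⟶ B) :
    E.sigma.map (f ≫ g) = 0 := by
  obtain ⟨t, ht⟩ := hQ (E.cosyzι A) ⟨_, _, E.cosyz_conf A⟩ f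
  exact sigma_map_eq_zero_iff.2 ⟨t ≫ g, by rw [reassoc_of% ht]⟩

theorem Inflation.exists_comp_eq_of_sigma_map_eq_zero {A Q B : C} {q : A ⟶ Q}
    (hq : E.Inflation q) {f : A ⟶ B} (hf : E.sigma.map f = 0) : ∃ u : Q ⟶ B, q ≫ u = f := by
  obtain ⟨t, rfl⟩ := sigma_map_eq_zero_iff.1 hf
  obtain ⟨e, he⟩ := E.injHull_inj A q hq (E.cosyzι A)
  exact ⟨e ≫ t, by rw [reassoc_of% he]⟩

theorem exists_δ_eq {A B : C} (x : E.stab.obj A ⟶ E.sigma.obj B) :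
    ∃ (M : C) (k : B ⟶ M) (c : M ⟶ A) (h : E.Conf k c), h.δ = x := by
  have := (E.cosyz_conf B).isIso_δ (E.injHull_inj B)
  obtain ⟨s, hs⟩ := E.stab.map_surjective (x ≫ inv (E.cosyz_conf B).δ)
  obtain ⟨M, k, c, m, pb, h, hk⟩ := (E.cosyz_conf B).exists_pullback s
  refine ⟨M, k, c, h, ?_⟩
  rw [(E.cosyz_conf B).δ_pullback h hk pb.w, hs, Category.assoc, IsIso.inv_hom_id,
    Category.comp_id]

theorem extOrthogonal_iff {X A B Y : C} {f : X ⟶ A} {g : B ⟶ Y} :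
    E.ExtOrthogonal f g ↔ MorIdeal.HomOrthogonal (E.stab.map f) (E.sigma.map g) := by
  constructor
  · intro H x
    obtain ⟨M, k, c, h, rfl⟩ := exists_δ_eq x
    obtain ⟨M', k', c', m, pb, h', hk⟩ := h.exists_pullback f
    obtain ⟨M'', k'', c'', n, po, h'', hc⟩ := h'.exists_pushout g
    have h0 := h''.exists_section_iff.1 (H k c k' c' k'' c'' m n h h' h'' pb hk po hc)
    rwa [h'.δ_pushout h'' po.w hc, h.δ_pullback h' hk pb.w, Category.assoc] at h0
  · intro H M M' M'' k c k' c' k'' c'' m n h h' h'' pb hk po hc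
    rw [h''.exists_section_iff, h'.δ_pushout h'' po.w hc, h.δ_pullback h' hk pb.w, Category.assoc]
    exact H h.δ

theorem isCotorsionPair_iff {I J : MorIdeal C} :
    E.IsCotorsionPair I J ↔ I = (J.image E.sigma).leftPerp.comap E.stab ∧
      J = (I.image E.stab).rightPerp.comap E.sigma := by
  simp only [MorIdeal.eq_iff, MorIdeal.mem_comap, MorIdeal.mem_leftPerp_image,
    MorIdeal.mem_rightPerp_image, ← extOrthogonal_iff]
  rfl

end Connecting

/-! ### Distinguished triangles -/

section Triangles

variable [E.IsFrobenius]

theorem stableWeakConf_of_isPushout {A B D : C} {f : A ⟶ B} {q : E.injHull A ⟶ D} {g : B ⟶ D}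
    (po : IsPushout (E.cosyzι A) f q g) : E.StableWeakConf (E.stab.map f) (E.stab.map g) := by
  obtain ⟨w, h, hw⟩ := (E.cosyz_conf A).pushout po
  refine ⟨E.stab.map w, A, B, D, f, g, q, w, Iso.refl _, Iso.refl _, Iso.refl _, po, hw, h.1,
    by simp, by simp, ?_⟩
  rw [Iso.refl_hom, E.stableShift.map_id, Iso.refl_hom, Category.id_comp]
  exact Category.comp_id _

theorem StableWeakConf.of_iso {X Y Z X' Y' Z' : E.Stable} {x : X ⟶ Y} {y : Y ⟶ Z} {x' : X' ⟶ Y'}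
    {y' : Y' ⟶ Z'} (h : E.StableWeakConf x y) (a : X' ≅ X) (b : Y' ≅ Y) (d : Z' ≅ Z)
    (hx : x' ≫ b.hom = a.hom ≫ x) (hy : y' ≫ d.hom = b.hom ≫ y) : E.StableWeakConf x' y' := by
  obtain ⟨z, A, B, D, f, g, q, w, a₀, b₀, d₀, po, hqw, hgw, hf, hg, hz⟩ := h
  refine ⟨d.hom ≫ z ≫ E.stableShift.map a.inv, A, B, D, f, g, q, w, a ≪≫ a₀, b ≪≫ b₀, d ≪≫ d₀,
    po, hqw, hgw, ?_, ?_, ?_⟩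
  · rw [Iso.trans_hom, reassoc_of% hx, hf, Iso.trans_hom, Category.assoc]
  · rw [Iso.trans_hom, reassoc_of% hy, hg, Iso.trans_hom, Category.assoc]
  · rw [Iso.trans_hom, Category.assoc, Category.assoc, ← E.stableShift.map_comp,
      a.inv_hom_id_assoc, hz]
    exact (Category.assoc _ _ _).symm

theorem Conf.stableWeakConf {A B D : C} {k : A ⟶ B} {c : B ⟶ D} (h : E.Conf k c) :
    E.StableWeakConf (E.stab.map k) (E.stab.map c) := by
  obtain ⟨N, g, -, q, po, -⟩ := (E.cosyz_conf A).exists_pushout k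
  obtain ⟨c', h', rfl⟩ := h.pushout po.flip
  have := h'.isIso_stab_map_of_inj (E.injHull_inj A)
  exact (stableWeakConf_of_isPushout po).of_iso (Iso.refl _) (Iso.refl _)
    (asIso (E.stab.map c')).symm (by simp) (by simp)

theorem exists_stableWeakConf_right {X Y : E.Stable} (x : X ⟶ Y) :
    ∃ (Z : E.Stable) (y : Y ⟶ Z), E.StableWeakConf x y := by
  obtain ⟨f, rfl⟩ := E.stab.map_surjective (X := X.as) (Y := Y.as) x
  obtain ⟨D, g, -, q, po, -⟩ := (E.cosyz_conf X.as).exists_pushout f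
  exact ⟨_, _, stableWeakConf_of_isPushout po⟩

theorem exists_stableWeakConf_left {Y Z : E.Stable} (y : Y ⟶ Z) :
    ∃ (X : E.Stable) (x : X ⟶ Y), E.StableWeakConf x y := by
  obtain ⟨f, rfl⟩ := E.stab.map_surjective (X := Y.as) (Y := Z.as) y
  obtain ⟨P, p, hP, hp⟩ := IsFrobenius.enough_proj (E := E) Z.as
  obtain ⟨K, k, h⟩ := hp.biprod_desc f
  have := isIso_stab_map_biprod_inl Y.as hP
  let b := asIso (E.stab.map (biprod.inl : Y.as ⟶ Y.as ⊞ P))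
  exact ⟨_, E.stab.map k ≫ b.inv, h.stableWeakConf.of_iso (Iso.refl _) b (Iso.refl _) (by simp)
    (by simp [b, ← E.stab.map_comp])⟩

end Triangles

/-! ### Special approximations -/

section Approximations

variable {I J : MorIdeal C}

theorem isPrecover_biprod_desc (hI : (I.image E.stab).comap E.stab = I) {T P X : C} {i : T ⟶ X}
    (hi : (I.image E.stab).IsPrecover (E.stab.map i)) {p : P ⟶ X} (hP : E.Proj P)
    (hp : E.Deflation p) : I.IsPrecover (biprod.desc i p) := by
  refine ⟨?_, fun T' i' hi' => ?_⟩
  · have hdesc : E.stab.map (biprod.desc i p) = E.stab.map biprod.fst ≫ E.stab.map i := by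
      rw [biprod.desc_eq, E.stab.map_add, stab_map_comp_eq_zero hP, add_zero, E.stab.map_comp]
    rw [← hI, MorIdeal.mem_comap, hdesc]
    exact MorIdeal.comp_left_mem _ _ hi.1
  · obtain ⟨t, ht⟩ := hi.2 (E.stab.map i') (MorIdeal.map_mem_image hi')
    obtain ⟨t, rfl⟩ := E.stab.map_surjective t
    obtain ⟨u, hu⟩ := hp.exists_comp_eq_of_stab_map_eq_zero (f := i' - t ≫ i)
      (by rw [E.stab.map_sub, E.stab.map_comp, ht, sub_self])
    exact ⟨biprod.lift t u, by rw [biprod.lift_desc, hu, add_sub_cancel]⟩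

variable [E.IsFrobenius]

theorem IsExtSpecialPrecover.isPrecover {T X : C} {i : T ⟶ X}
    (hi : E.IsExtSpecialPrecover I i) : I.IsPrecover i := by
  obtain ⟨hiI, K, P, F, k, p, l, g, f, -, hkp, hli, hg, hf, hortho⟩ := hi
  refine ⟨hiI, fun T' i' hi' => ?_⟩
  rw [hli.exists_lift_iff, hkp.δ_pushout hli hg.symm hf]
  exact extOrthogonal_iff.1 (hortho i' hi') hkp.δ

-- As `δ` of `K ⟶ P ⟶ X` is an isomorphism, every morphism to `π(Σ(K))` factors through it, which
-- turns `Ext(i', g) = 0` into a lifting problem along `i`.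
theorem isExtSpecialPrecover_of_isPrecover {T X : C} {i : T ⟶ X} (hi : I.IsPrecover i)
    (hdef : E.Deflation i) : E.IsExtSpecialPrecover I i := by
  obtain ⟨F, l, hli⟩ := hdef
  obtain ⟨P, p, hP, K, k, hkp⟩ := IsFrobenius.enough_proj (E := E) X
  obtain ⟨f, hf⟩ := hP i ⟨F, l, hli⟩ p
  obtain ⟨g, hg⟩ := hli.lift (k ≫ f) (by rw [Category.assoc, hf, hkp.1])
  refine ⟨hi.1, K, P, F, k, p, l, g, f, hP, hkp, hli, hg, hf, fun X' A' i' hi' => ?_⟩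
  rw [extOrthogonal_iff]
  intro x
  have := hkp.isIso_δ ((IsFrobenius.proj_iff_inj P).1 hP)
  obtain ⟨y, hy⟩ := E.stab.map_surjective (x ≫ inv hkp.δ)
  obtain rfl : x = E.stab.map y ≫ hkp.δ := by rw [hy, Category.assoc, IsIso.inv_hom_id]; simp
  have hlift := (hli.exists_lift_iff (i' ≫ y)).1 (hi.2 _ (I.comp_right_mem y hi'))
  rwa [hkp.δ_pushout hli hg.symm hf, E.stab.map_comp, Category.assoc,
    ← Category.assoc (E.stab.map y)] at hlift

theorem IsExtSpecialPreenvelope.isPreenvelope {X F : C} {j : X ⟶ F}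
    (hj : E.IsExtSpecialPreenvelope J j) : J.IsPreenvelope j := by
  obtain ⟨hjJ, T, Q, K, q, c, d, g, f, -, hqc, hjd, hg, hf, hortho⟩ := hj
  refine ⟨hjJ, fun F' j' hj' => ?_⟩
  rw [hjd.exists_extension_iff, hqc.δ_pullback hjd hf hg.symm, Category.assoc]
  exact extOrthogonal_iff.1 (hortho j' hj') hqc.δ

theorem isExtSpecialPreenvelope_of_isPreenvelope {X F : C} {j : X ⟶ F} (hj : J.IsPreenvelope j)
    (hinf : E.Inflation j) : E.IsExtSpecialPreenvelope J j := by
  obtain ⟨T, d, hjd⟩ := hinf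
  obtain ⟨Q, q, hQ, K, c, hqc⟩ := IsFrobenius.enough_inj (E := E) X
  obtain ⟨f, hf⟩ := hQ j ⟨T, d, hjd⟩ q
  obtain ⟨g, hg⟩ := hjd.desc (f ≫ c) (by rw [reassoc_of% hf, hqc.1])
  refine ⟨hj.1, T, Q, K, q, c, d, g, f, hQ, hqc, hjd, hg, hf, fun B' Y' j' hj' => ?_⟩
  rw [extOrthogonal_iff]
  intro x
  have := hqc.isIso_δ hQ
  obtain ⟨y, hy⟩ := E.sigma.map_surjective (inv hqc.δ ≫ x)
  obtain rfl : x = hqc.δ ≫ E.sigma.map y := by rw [hy, IsIso.hom_inv_id_assoc]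
  have hext := (hjd.exists_extension_iff (y ≫ j')).1 (hj.2 _ (J.comp_left_mem y hj'))
  rwa [hqc.δ_pullback hjd hf hg.symm, E.sigma.map_comp, Category.assoc,
    ← Category.assoc hqc.δ] at hext

theorem isPreenvelope_biprod_lift (hJ : (J.image E.sigma).comap E.sigma = J) {X F Q : C}
    {j : X ⟶ F} (hj : (J.image E.sigma).IsPreenvelope (E.sigma.map j)) {q : X ⟶ Q}
    (hQ : E.Inj Q) (hq : E.Inflation q) : J.IsPreenvelope (biprod.lift j q) := by
  refine ⟨?_, fun F' j' hj' => ?_⟩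
  · have hlift : E.sigma.map (biprod.lift j q) = E.sigma.map j ≫ E.sigma.map biprod.inl := by
      rw [biprod.lift_eq, E.sigma.map_add, sigma_map_comp_eq_zero hQ, add_zero, E.sigma.map_comp]
    rw [← hJ, MorIdeal.mem_comap, hlift]
    exact MorIdeal.comp_right_mem _ _ hj.1
  · obtain ⟨t, ht⟩ := hj.2 (E.sigma.map j') (MorIdeal.map_mem_image hj')
    obtain ⟨t, rfl⟩ := E.sigma.map_surjective t
    obtain ⟨u, hu⟩ := hq.exists_comp_eq_of_sigma_map_eq_zero (f := j' - j ≫ t)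
      (by rw [E.sigma.map_sub, E.sigma.map_comp, ht, sub_self])
    exact ⟨biprod.desc t u, by rw [biprod.lift_desc, hu, add_sub_cancel]⟩

theorem forall_exists_isExtSpecialPrecover_iff (hI : (I.image E.stab).comap E.stab = I) :
    (∀ X : C, ∃ (T : C) (i : T ⟶ X), E.IsExtSpecialPrecover I i) ↔
      MorIdeal.HomSpecialPrecovering E.StableWeakConf (I.image E.stab) := by
  simp only [MorIdeal.HomSpecialPrecovering, exists_stableWeakConf_right, and_true,
    MorIdeal.forall_exists_isPrecover_iff_map E.stab]
  refine forall_congr' fun X => ⟨fun ⟨T, i, hi⟩ => ⟨T, i, hi.isPrecover.map⟩, fun ⟨T, i, hi⟩ => ?_⟩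
  obtain ⟨P, p, hP, hp⟩ := IsFrobenius.enough_proj (E := E) X
  exact ⟨_, _, isExtSpecialPrecover_of_isPrecover (isPrecover_biprod_desc hI hi hP hp)
    (hp.biprod_desc i)⟩

theorem forall_exists_isExtSpecialPreenvelope_iff (hJ : (J.image E.sigma).comap E.sigma = J) :
    (∀ X : C, ∃ (F : C) (j : X ⟶ F), E.IsExtSpecialPreenvelope J j) ↔
      MorIdeal.HomSpecialPreenveloping E.StableWeakConf (J.image E.sigma) := by
  simp only [MorIdeal.HomSpecialPreenveloping, exists_stableWeakConf_left, and_true,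
    MorIdeal.forall_exists_isPreenvelope_iff_map E.sigma]
  refine forall_congr' fun X => ⟨fun ⟨F, j, hj⟩ => ⟨F, j, hj.isPreenvelope.map⟩,
    fun ⟨F, j, hj⟩ => ?_⟩
  obtain ⟨Q, q, hQ, hq⟩ := IsFrobenius.enough_inj (E := E) X
  exact ⟨_, _, isExtSpecialPreenvelope_of_isPreenvelope (isPreenvelope_biprod_lift hJ hj hQ hq)
    (hq.biprod_lift j)⟩

end Approximations

end ExactStructure

theorem theoremT {C : Type u} [Category.{v} C] [Preadditive C] [HasFiniteBiproducts C]
    (E : ExactStructure C) [E.IsFrobenius] :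
    Set.BijOn
      (fun p : MorIdeal C × MorIdeal C => (p.1.image E.stab, p.2.image E.sigma))
      {p | E.IsCotorsionPair p.1 p.2}
      {q : MorIdeal E.Stable × MorIdeal E.Stable | MorIdeal.IsTorsionPair q.1 q.2} ∧
    ∀ I J : MorIdeal C, E.IsCotorsionPair I J →
      (E.IsCompleteCotorsionPair I J ↔
        MorIdeal.IsCompleteTorsionPair E.StableWeakConf (I.image E.stab) (J.image E.sigma)) := by
  have hbij : Set.BijOn (fun p : MorIdeal C × MorIdeal C => (p.1.image E.stab, p.2.image E.sigma))
      {p | E.IsCotorsionPair p.1 p.2} {q | MorIdeal.IsTorsionPair q.1 q.2} := by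
    simpa only [ExactStructure.isCotorsionPair_iff] using
      MorIdeal.bijOn_image_isTorsionPair E.stab E.sigma
  refine ⟨hbij, fun I J hIJ => ?_⟩
  have htors : MorIdeal.IsTorsionPair (I.image E.stab) (J.image E.sigma) :=
    hbij.mapsTo (x := (I, J)) hIJ
  obtain ⟨hI, hJ⟩ := ExactStructure.isCotorsionPair_iff.1 hIJ
  have hpre := ExactStructure.forall_exists_isExtSpecialPrecover_iff
    (MorIdeal.comap_image_of_eq_comap hI)
  have henv := ExactStructure.forall_exists_isExtSpecialPreenvelope_iff
    (MorIdeal.comap_image_of_eq_comap hJ)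
  exact ⟨fun h => ⟨htors, hpre.1 h.precovering, henv.1 h.preenveloping⟩,
    fun h => ⟨hIJ, hpre.2 h.precovering, henv.2 h.preenveloping⟩⟩
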